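/- Call a Borel probability measure $\mu$ on $\mathbb R^n$ log-concave if $\mu(\lambda A+(1-\lambda)B)\ge \mu(A)^{\lambda}\mu(B)^{1-\lambda}$ for all compact sets $A,B\subseteq\mathbb R^n$ and all $\lambda\in(0,1)$, and $\mu(H)<1$ for every hyperplane $H$ of $\mathbb R^n$. Let $\varphi_\mu(x)=\inf\{\mu(H): H \text{ a closed half-space of } \mathbb R^n \text{ with } x\in H\}$ be Tukey's half-space depth. Then there is an absolute constant $c>0$ such that for every $n\ge 1$ and every log-concave probability measure $\mu$ on $\mathbb R^n$, the function $\varphi_\mu$ is $\mu$-integrable and $$\int_{\mathbb R^n}\varphi_\mu(x)\,d\mu(x)\ \ge\ e^{-cn}.$$ -/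

import Mathlib

open MeasureTheory
open scoped Pointwise ENNReal

/-- A hyperplane of `ℝⁿ`: a set `{y | ⟨v, y⟩ = a}` with `v ≠ 0`. -/
def IsHyperplane {n : ℕ} (H : Set (EuclideanSpace ℝ (Fin n))) : Prop :=
  ∃ v : EuclideanSpace ℝ (Fin n), v ≠ 0 ∧ ∃ a : ℝ, H = {y | inner ℝ v y = a}

/-- A (closed) half-space of `ℝⁿ`: a set `{y | a ≤ ⟨v, y⟩}` with `v ≠ 0`. -/
def IsHalfSpace {n : ℕ} (H : Set (EuclideanSpace ℝ (Fin n))) : Prop :=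
  ∃ v : EuclideanSpace ℝ (Fin n), v ≠ 0 ∧ ∃ a : ℝ, H = {y | a ≤ inner ℝ v y}

/-- Non-degenerate log-concave Borel measures on `ℝⁿ`: no hyperplane carries mass `1`, and
`μ(lA + (1-l)B) ≥ μ(A)^l μ(B)^(1-l)` for all compact `A, B` and `0 < l < 1`. -/
structure IsLogConcaveMeasure {n : ℕ} (μ : Measure (EuclideanSpace ℝ (Fin n))) : Prop where
  hyperplane_lt_one : ∀ H : Set (EuclideanSpace ℝ (Fin n)), IsHyperplane H → μ H < 1
  rpow_mul_rpow_le : ∀ A B : Set (EuclideanSpace ℝ (Fin n)), IsCompact A → IsCompact B →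
    ∀ l : ℝ, 0 < l → l < 1 → μ A ^ l * μ B ^ (1 - l) ≤ μ (l • A + (1 - l) • B)

/-- Tukey's half-space depth: the infimum of the masses of the half-spaces containing `x`.
For `n ≥ 1` the infimum is over a nonempty set of reals, bounded below by `0`. -/
noncomputable def halfSpaceDepth {n : ℕ} (μ : Measure (EuclideanSpace ℝ (Fin n)))
    (x : EuclideanSpace ℝ (Fin n)) : ℝ :=
  sInf {r : ℝ | ∃ H : Set (EuclideanSpace ℝ (Fin n)), IsHalfSpace H ∧ x ∈ H ∧ r = μ.real H}

/-! Suppose first that the measure has density `h ^ 2` with `h x * h y ≤ h (midpoint) ^ 2`. By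
Helly's theorem some `p` has depth at least `η = 1 / (n + 2)`, and log-concavity makes `h p` at
least `s = 2⁻ⁿ * η / 2` times any value of `h` (`mul_le_of_le_depth`). Write `x` as the midpoint of
`p` and `q = 2x - p`. Contracting by 1/2 towards `q` sends each half-space bounded at `p` into its
translate bounded at `x`, so the depth of `x` is at least `s * η * 2⁻ⁿ * h q / h p`
(`mul_le_mul_setLIntegral_halfSpace`). Multiplied by `h x ^ 2 ≥ h q * h p`, this leaves a multiple
of `h (2x - p) ^ 2`, whose integral is `2⁻ⁿ`; the total is `8⁻ⁿ * η ^ 2 / 2`.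

No density is assumed for `μ`, so the bound is applied to its average over balls of radius `ε`. This
costs a shift of `2 * ε` in the half-spaces (`lintegral_shiftedDepth_ballAverage_le`), removed by
monotone convergence as `ε → 0`. -/

open Module Metric Set Filter Topology

/-! ### Shifted depth, its semicontinuity, and centerpoints. -/

section Depth

variable {E : Type*} [NormedAddCommGroup E] [InnerProductSpace ℝ E] [MeasurableSpace E]

/-- A variant of the half-space depth in which the half-spaces are enlarged by `δ`. -/
noncomputable def shiftedDepth (ν : Measure E) (δ : ℝ) (x : E) : ℝ≥0∞ :=
  ⨅ u : sphere (0 : E) 1, ν {y | inner ℝ (u : E) x - δ ≤ inner ℝ (u : E) y}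

theorem shiftedDepth_mono (ν : Measure E) (x : E) : Monotone fun δ => shiftedDepth ν δ x := by
  intro a b hab
  refine iInf_mono fun u => measure_mono fun y hy => ?_
  simp only [mem_ofPred_eq] at hy ⊢
  linarith

variable [BorelSpace E]

theorem measurableSet_le_inner (u : E) (a : ℝ) : MeasurableSet {y : E | a ≤ inner ℝ u y} :=
  (isClosed_le continuous_const (by fun_prop)).measurableSet

/-- Half-spaces are regular from outside along parallel half-spaces. -/
theorem exists_pos_measure_le_inner_lt {ν : Measure E} [IsFiniteMeasure ν] {u : E} {a : ℝ} {t : ℝ≥0∞}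
    (h : ν {y | a ≤ inner ℝ u y} < t) : ∃ δ > 0, ν {y | a - δ ≤ inner ℝ u y} < t := by
  have hanti : Antitone fun k : ℕ => {y : E | a - 1 / ((k : ℝ) + 1) ≤ inner ℝ u y} := by
    intro i j hij y hy
    have : 1 / ((j : ℝ) + 1) ≤ 1 / ((i : ℝ) + 1) := Nat.one_div_le_one_div hij
    simp only [mem_ofPred_eq] at hy ⊢
    linarith
  have hInter : ⋂ k : ℕ, {y : E | a - 1 / ((k : ℝ) + 1) ≤ inner ℝ u y} =
      {y | a ≤ inner ℝ u y} := by
    ext y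
    simp only [mem_iInter, mem_ofPred_eq]
    constructor
    · intro hy
      have hl : Tendsto (fun k : ℕ => a - 1 / ((k : ℝ) + 1)) atTop (𝓝 (a - 0)) :=
        tendsto_const_nhds.sub tendsto_one_div_add_atTop_nhds_zero_nat
      rw [sub_zero] at hl
      exact le_of_tendsto' hl hy
    · intro hy k
      have : 0 < 1 / ((k : ℝ) + 1) := Nat.one_div_pos_of_nat
      linarith
  have hlim := tendsto_measure_iInter_atTop (μ := ν)
    (fun k : ℕ => (measurableSet_le_inner u (a - 1 / ((k : ℝ) + 1))).nullMeasurableSet) hanti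
    ⟨0, measure_ne_top _ _⟩
  rw [hInter] at hlim
  obtain ⟨k, hk⟩ := (hlim.eventually_lt_const h).exists
  exact ⟨1 / ((k : ℝ) + 1), Nat.one_div_pos_of_nat, hk⟩

theorem upperSemicontinuous_shiftedDepth (ν : Measure E) [IsFiniteMeasure ν] (δ : ℝ) :
    UpperSemicontinuous (shiftedDepth ν δ) := by
  refine upperSemicontinuous_iInf fun u x t ht => ?_
  obtain ⟨ε, hε, hlt⟩ := exists_pos_measure_le_inner_lt ht
  have hc : Continuous fun y : E => inner ℝ (u : E) y := by fun_prop
  filter_upwards [hc.continuousAt.eventually_const_lt (sub_lt_self (inner ℝ (u : E) x) hε)]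
    with x' hx'
  refine (measure_mono fun y hy => ?_).trans_lt hlt
  simp only [mem_ofPred_eq] at hy ⊢
  linarith

theorem shiftedDepth_zero_eq_iInf (ν : Measure E) [IsFiniteMeasure ν] (x : E) :
    shiftedDepth ν 0 x = ⨅ k : ℕ, shiftedDepth ν (2 * (1 / ((k : ℝ) + 1))) x := by
  refine le_antisymm (le_iInf fun k => shiftedDepth_mono ν x ?_) ?_
  · have : 0 < 1 / ((k : ℝ) + 1) := Nat.one_div_pos_of_nat
    linarith
  · refine le_iInf fun u => le_of_forall_gt fun t ht => ?_
    obtain ⟨ε, hε, hlt⟩ := exists_pos_measure_le_inner_lt ht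
    obtain ⟨k, hk⟩ := exists_nat_one_div_lt (half_pos hε)
    refine (iInf_le _ k).trans_lt ((iInf_le _ u).trans_lt ((measure_mono fun y hy => ?_).trans_lt hlt))
    simp only [mem_ofPred_eq] at hy ⊢
    linarith

variable [FiniteDimensional ℝ E]

/-- The centerpoint theorem: some point has half-space depth at least `1 / (n + 2)`. -/
theorem exists_centerpoint (ν : Measure E) [IsProbabilityMeasure ν] :
    ∃ p : E, ∀ u : E, ((finrank ℝ E + 2 : ℕ) : ℝ≥0∞)⁻¹ ≤ ν {y | inner ℝ u p ≤ inner ℝ u y} := by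
  -- With `n + 2` in place of the sharp `n + 1`, any `n + 1` complements have total mass strictly
  -- below 1.
  set θ : ℝ≥0∞ := ((finrank ℝ E + 2 : ℕ) : ℝ≥0∞)⁻¹ with hθ
  have key : (⋂ S : {S : Set E // Convex ℝ S ∧ IsCompact S ∧ ν Sᶜ ≤ θ}, (S : Set E)).Nonempty := by
    refine Convex.helly_theorem_compact' (𝕜 := ℝ) (fun S => S.2.1) (fun S => S.2.2.1) fun I hI => ?_
    by_contra hne
    rw [not_nonempty_iff_eq_empty] at hne
    have h1 : ν (⋃ S ∈ I, (S : Set E)ᶜ) = 1 := by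
      rw [← compl_iInter₂, hne, compl_empty, measure_univ]
    have h2 : (1 : ℝ≥0∞) ≤ ((finrank ℝ E + 1 : ℕ) : ℝ≥0∞) * θ :=
      calc (1 : ℝ≥0∞) = ν (⋃ S ∈ I, (S : Set E)ᶜ) := h1.symm
        _ ≤ ∑ S ∈ I, ν (S : Set E)ᶜ := measure_biUnion_finset_le _ _
        _ ≤ ∑ S ∈ I, θ := Finset.sum_le_sum fun S _ => S.2.2.2
        _ = (I.card : ℝ≥0∞) * θ := by rw [Finset.sum_const, nsmul_eq_mul]
        _ ≤ _ := by gcongr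
    rw [hθ, ← div_eq_mul_inv, ENNReal.le_div_iff_mul_le (by simp) (by simp), one_mul,
      Nat.cast_le] at h2
    omega
  obtain ⟨p, hp⟩ := key
  refine ⟨p, fun u => ?_⟩
  by_contra! hlt
  -- Compact convex sets exhausting the open half-space that misses `p`: one of them belongs to the
  -- Helly family, yet none contains `p`.
  set C : ℕ → Set E := fun k =>
    {y | inner ℝ u y ≤ inner ℝ u p - 1 / ((k : ℝ) + 1)} ∩ closedBall 0 k with hC
  have hclosed : ∀ k, IsClosed {y : E | inner ℝ u y ≤ inner ℝ u p - 1 / ((k : ℝ) + 1)} := fun k =>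
    isClosed_le (by fun_prop) continuous_const
  have hcompact : ∀ k, IsCompact (C k) := fun k =>
    (isCompact_closedBall _ _).inter_left (hclosed k)
  have hmono : Monotone C := by
    intro i j hij y hy
    have : 1 / ((j : ℝ) + 1) ≤ 1 / ((i : ℝ) + 1) := Nat.one_div_le_one_div hij
    refine ⟨?_, closedBall_subset_closedBall (by exact_mod_cast hij) hy.2⟩
    have := hy.1
    simp only [mem_ofPred_eq] at this ⊢
    linarith
  have hUnion : ⋃ k, C k = {y | inner ℝ u p ≤ inner ℝ u y}ᶜ := by
    ext y
    simp only [mem_iUnion, mem_compl_iff, mem_ofPred_eq, not_le]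
    constructor
    · rintro ⟨k, hk, -⟩
      have : 0 < 1 / ((k : ℝ) + 1) := Nat.one_div_pos_of_nat
      simp only [mem_ofPred_eq] at hk
      linarith
    · intro hy
      obtain ⟨k, hk⟩ := exists_nat_one_div_lt (sub_pos.2 hy)
      obtain ⟨m, hm⟩ := exists_nat_ge ‖y‖
      have h1 : 1 / (((max k m : ℕ) : ℝ) + 1) ≤ 1 / ((k : ℝ) + 1) :=
        Nat.one_div_le_one_div (le_max_left _ _)
      have h2 : (m : ℝ) ≤ ((max k m : ℕ) : ℝ) := by exact_mod_cast le_max_right k m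
      refine ⟨max k m, ?_, ?_⟩
      · simp only [mem_ofPred_eq]
        linarith
      · rw [mem_closedBall_zero_iff]
        exact hm.trans h2
  have hlim := tendsto_measure_iInter_atTop (μ := ν) (s := fun k => (C k)ᶜ)
    (fun k => (hcompact k).measurableSet.compl.nullMeasurableSet)
    (fun i j hij => compl_subset_compl.2 (hmono hij)) ⟨0, measure_ne_top _ _⟩
  rw [← compl_iUnion, hUnion, compl_compl] at hlim
  obtain ⟨k, hk⟩ := (hlim.eventually_lt_const hlt).exists
  have hconv : Convex ℝ (C k) :=
    (convex_halfSpace_le (innerₗ E u).isLinear _).inter (convex_closedBall _ _)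
  have hmem : p ∈ C k := mem_iInter.1 hp ⟨C k, hconv, hcompact k, hk.le⟩
  have h1 := hmem.1
  have : 0 < 1 / ((k : ℝ) + 1) := Nat.one_div_pos_of_nat
  simp only [mem_ofPred_eq] at h1
  linarith

theorem lintegral_comp_smul_add {r : ℝ} (hr : r ≠ 0) (v : E) {F : E → ℝ≥0∞} (hF : Measurable F) :
    ∫⁻ x, F (r • x + v) = ENNReal.ofReal |(r ^ finrank ℝ E)⁻¹| * ∫⁻ x, F x := by
  have h := lintegral_map (μ := (volume : Measure E)) (f := fun x => F (x + v))
    (g := fun x : E => r • x) (by fun_prop) (by fun_prop)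
  rw [← h, Measure.map_addHaar_smul _ hr, lintegral_smul_measure, smul_eq_mul,
    lintegral_add_right_eq_self]

end Depth

/-! ### The bound for log-concave densities. -/

section Density

variable {E : Type*} [NormedAddCommGroup E] [InnerProductSpace ℝ E] [FiniteDimensional ℝ E]
  [MeasurableSpace E] [BorelSpace E]

theorem lintegral_comp_half_smul_add (v : E) {F : E → ℝ≥0∞} (hF : Measurable F) :
    ∫⁻ x, F ((2⁻¹ : ℝ) • (v + x)) = 2 ^ finrank ℝ E * ∫⁻ x, F x := by
  have h := lintegral_comp_smul_add (r := 2⁻¹) (by norm_num) ((2⁻¹ : ℝ) • v) hF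
  have hc : ENNReal.ofReal |((2⁻¹ : ℝ) ^ finrank ℝ E)⁻¹| = 2 ^ finrank ℝ E := by
    rw [inv_pow, inv_inv, abs_of_pos (by positivity), ENNReal.ofReal_pow (by norm_num)]
    norm_num
  rw [← hc, ← h]
  simp only [smul_add, add_comm]

theorem lintegral_comp_two_smul_sub (p : E) {F : E → ℝ≥0∞} (hF : Measurable F) :
    ∫⁻ x, F ((2 : ℝ) • x - p) = (2 ^ finrank ℝ E)⁻¹ * ∫⁻ x, F x := by
  have h := lintegral_comp_smul_add (r := 2) (by norm_num) (-p) hF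
  have hc : ENNReal.ofReal |((2 : ℝ) ^ finrank ℝ E)⁻¹| = (2 ^ finrank ℝ E)⁻¹ := by
    rw [abs_of_pos (by positivity), ENNReal.ofReal_inv_of_pos (by positivity),
      ENNReal.ofReal_pow (by norm_num)]
    norm_num
  rw [← hc, ← h]
  simp only [sub_eq_add_neg]

variable {h : E → ℝ≥0∞} {η : ℝ≥0∞} {p : E}

/-- A log-concave density `h ^ 2` at a point of half-space depth at least `η` is comparable to its
maximum. -/
theorem mul_le_of_le_depth (hm : Measurable h) (hclosed : ∀ t, IsClosed {x | t ≤ h x})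
    (hconvex : ∀ t, Convex ℝ {x | t ≤ h x})
    (hmid : ∀ x y, h x * h y ≤ h ((2⁻¹ : ℝ) • (x + y)) ^ 2) (hint : ∫⁻ x, h x ^ 2 = 1)
    (hη0 : η ≠ 0) (hη : η ≠ ∞)
    (hp : ∀ u : E, η ≤ ∫⁻ y in {y | inner ℝ u p ≤ inner ℝ u y}, h y ^ 2) (z : E) :
    (2 ^ finrank ℝ E)⁻¹ * (η / 2) * h z ≤ h p := by
  -- Chosen so that `s * 2 ^ n = η / 2`, which contradicts the depth of `p`.
  set s : ℝ≥0∞ := (2 ^ finrank ℝ E)⁻¹ * (η / 2) with hs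
  by_contra! hlt
  -- If `p` lies outside a superlevel set, a half-space bounded at `p` avoids that set, so `h` is
  -- small throughout it.
  obtain ⟨f, a, hfa, hfb⟩ := geometric_hahn_banach_point_closed (x := p) (hconvex (s * h z))
    (hclosed (s * h z)) (by simpa using hlt)
  set u : E := -(InnerProductSpace.toDual ℝ E).symm f with hu
  have hin : ∀ y, inner ℝ u y = -f y := fun y => by
    rw [hu, inner_neg_left, InnerProductSpace.toDual_symm_apply]
  have hsmall : ∀ y ∈ {y | inner ℝ u p ≤ inner ℝ u y},
      h y ^ 2 ≤ s * h ((2⁻¹ : ℝ) • (z + y)) ^ 2 := by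
    intro y hy
    have hy' : h y < s * h z := by
      by_contra! hge
      have h1 := hfb y hge
      rw [mem_ofPred_eq, hin, hin] at hy
      linarith
    calc h y ^ 2 = h y * h y := sq _
      _ ≤ (s * h z) * h y := by gcongr
      _ = s * (h z * h y) := mul_assoc _ _ _
      _ ≤ _ := by gcongr; exact hmid z y
  have : η ≤ η / 2 :=
    calc η ≤ ∫⁻ y in {y | inner ℝ u p ≤ inner ℝ u y}, h y ^ 2 := hp u
      _ ≤ ∫⁻ y in {y | inner ℝ u p ≤ inner ℝ u y}, s * h ((2⁻¹ : ℝ) • (z + y)) ^ 2 :=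
        setLIntegral_mono' (measurableSet_le_inner u _) hsmall
      _ ≤ ∫⁻ y, s * h ((2⁻¹ : ℝ) • (z + y)) ^ 2 := setLIntegral_le_lintegral _ _
      _ = s * 2 ^ finrank ℝ E := by
        rw [lintegral_const_mul _ (by fun_prop),
          lintegral_comp_half_smul_add (F := fun x => h x ^ 2) z (by fun_prop), hint, mul_one]
      _ = η / 2 := by
        rw [hs, mul_right_comm, ENNReal.inv_mul_cancel (by simp) (by simp), one_mul]
  exact absurd this (not_le.2 (ENNReal.half_lt_self hη0 hη))

/-- The map `z ↦ (q + z) / 2` with `q = 2x - p` fixes `q` and sends `p` to `x`; `hs` trades one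
factor `h z` for `h p`, so that the left side integrates `h z ^ 2`. -/
theorem mul_le_mul_setLIntegral_halfSpace {s : ℝ≥0∞} (hm : Measurable h)
    (hmid : ∀ x y, h x * h y ≤ h ((2⁻¹ : ℝ) • (x + y)) ^ 2)
    (hp : ∀ u : E, η ≤ ∫⁻ y in {y | inner ℝ u p ≤ inner ℝ u y}, h y ^ 2)
    (hs : ∀ z, s * h z ≤ h p) (x u : E) :
    h ((2 : ℝ) • x - p) * s * η ≤
      h p * 2 ^ finrank ℝ E * ∫⁻ y in {y | inner ℝ u x ≤ inner ℝ u y}, h y ^ 2 := by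
  set q : E := (2 : ℝ) • x - p with hq
  set H : Set E := {y | inner ℝ u x ≤ inner ℝ u y} with hH
  have hHm : MeasurableSet H := measurableSet_le_inner u _
  have hpoint : ∀ z ∈ {y | inner ℝ u p ≤ inner ℝ u y}, h q * s * h z ^ 2 ≤
      h p * H.indicator (fun y => h y ^ 2) ((2⁻¹ : ℝ) • (q + z)) := by
    intro z hz
    have hzH : (2⁻¹ : ℝ) • (q + z) ∈ H := by
      simp only [hH, hq, mem_ofPred_eq, inner_smul_right, inner_add_right, inner_sub_right] at hz ⊢
      linarith
    rw [indicator_of_mem hzH]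
    calc h q * s * h z ^ 2 = (s * h z) * (h q * h z) := by ring
      _ ≤ h p * h ((2⁻¹ : ℝ) • (q + z)) ^ 2 := mul_le_mul' (hs z) (hmid q z)
  have hFm : Measurable (H.indicator fun y => h y ^ 2) := (hm.pow_const 2).indicator hHm
  calc h q * s * η ≤ h q * s * ∫⁻ z in {y | inner ℝ u p ≤ inner ℝ u y}, h z ^ 2 := by
        gcongr; exact hp u
    _ = ∫⁻ z in {y | inner ℝ u p ≤ inner ℝ u y}, h q * s * h z ^ 2 :=
        (lintegral_const_mul _ (by fun_prop)).symm
    _ ≤ ∫⁻ z in {y | inner ℝ u p ≤ inner ℝ u y},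
          h p * H.indicator (fun y => h y ^ 2) ((2⁻¹ : ℝ) • (q + z)) :=
        setLIntegral_mono' (measurableSet_le_inner u _) hpoint
    _ ≤ ∫⁻ z, h p * H.indicator (fun y => h y ^ 2) ((2⁻¹ : ℝ) • (q + z)) :=
        setLIntegral_le_lintegral _ _
    _ = h p * (2 ^ finrank ℝ E * ∫⁻ y in H, h y ^ 2) := by
        rw [lintegral_const_mul _ (by fun_prop), lintegral_comp_half_smul_add q hFm,
          lintegral_indicator hHm]
    _ = _ := (mul_assoc _ _ _).symm

/-- The expected half-space depth of a probability measure with log-concave density `h ^ 2`. -/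
theorem le_lintegral_shiftedDepth_of_density (hm : Measurable h) (hfin : ∀ x, h x ≠ ∞)
    (hclosed : ∀ t, IsClosed {x | t ≤ h x}) (hconvex : ∀ t, Convex ℝ {x | t ≤ h x})
    (hmid : ∀ x y, h x * h y ≤ h ((2⁻¹ : ℝ) • (x + y)) ^ 2) (hint : ∫⁻ x, h x ^ 2 = 1) :
    (8 ^ finrank ℝ E * (2 * ((finrank ℝ E + 2 : ℕ) : ℝ≥0∞) ^ 2))⁻¹ ≤
      ∫⁻ x, shiftedDepth (volume.withDensity fun x => h x ^ 2) 0 x * h x ^ 2 := by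
  set ν : Measure E := volume.withDensity fun x => h x ^ 2 with hν
  have : IsProbabilityMeasure ν := ⟨by rw [hν, withDensity_apply _ .univ, setLIntegral_univ, hint]⟩
  set η : ℝ≥0∞ := ((finrank ℝ E + 2 : ℕ) : ℝ≥0∞)⁻¹ with hη
  obtain ⟨p, hp⟩ := exists_centerpoint ν
  have hνapply : ∀ x u : E, ν {y | inner ℝ u x ≤ inner ℝ u y} =
      ∫⁻ y in {y | inner ℝ u x ≤ inner ℝ u y}, h y ^ 2 := fun x u =>
    withDensity_apply _ (measurableSet_le_inner u _)
  simp only [hνapply] at hp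
  set D : ℝ≥0∞ := 2 ^ finrank ℝ E with hD
  have hD0 : D ≠ 0 := by simp [hD]
  have hDt : D ≠ ∞ := by simp [hD]
  have hη0 : η ≠ 0 := by simp [hη]
  have hηt : η ≠ ∞ := by simp [hη]
  set s : ℝ≥0∞ := D⁻¹ * (η / 2) with hs
  have hsz : ∀ z, s * h z ≤ h p := mul_le_of_le_depth hm hclosed hconvex hmid hint hη0 hηt hp
  have hs0 : s ≠ 0 := by simp [hs, hDt, hη0]
  have hp0 : h p ≠ 0 := by
    intro h0
    have hz : ∀ z, h z = 0 := fun z => by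
      have := hsz z
      rw [h0, nonpos_iff_eq_zero, mul_eq_zero] at this
      exact this.resolve_left hs0
    simp [hz] at hint
  -- The factors `h p` cancel between the depth bound and the midpoint bound for `h x ^ 2`.
  have hdepth : ∀ x, s * η * D⁻¹ * h ((2 : ℝ) • x - p) ^ 2 ≤ shiftedDepth ν 0 x * h x ^ 2 := by
    intro x
    have h1 : h ((2 : ℝ) • x - p) * s * η * (h p * D)⁻¹ ≤ shiftedDepth ν 0 x := by
      refine le_iInf fun u => ?_
      rw [sub_zero, hνapply, ← div_eq_mul_inv]
      refine ENNReal.div_le_of_le_mul' ?_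
      exact mul_le_mul_setLIntegral_halfSpace hm hmid hp hsz x u
    have h2 : h ((2 : ℝ) • x - p) * h p ≤ h x ^ 2 := by
      convert hmid ((2 : ℝ) • x - p) p using 3
      rw [sub_add_cancel, smul_smul]
      norm_num
    calc s * η * D⁻¹ * h ((2 : ℝ) • x - p) ^ 2
        = (h ((2 : ℝ) • x - p) * s * η * (h p * D)⁻¹) * (h ((2 : ℝ) • x - p) * h p) := by
          rw [ENNReal.mul_inv (.inl hp0) (.inl (hfin p))]
          calc _ = s * η * D⁻¹ * h ((2 : ℝ) • x - p) ^ 2 * 1 := (mul_one _).symm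
            _ = s * η * D⁻¹ * h ((2 : ℝ) • x - p) ^ 2 * ((h p)⁻¹ * h p) := by
              rw [ENNReal.inv_mul_cancel hp0 (hfin p)]
            _ = _ := by ring
      _ ≤ _ := mul_le_mul' h1 h2
  have hconst : (8 ^ finrank ℝ E * (2 * ((finrank ℝ E + 2 : ℕ) : ℝ≥0∞) ^ 2))⁻¹ = s * η * D⁻¹ * D⁻¹ := by
    have h8 : (8 : ℝ≥0∞) ^ finrank ℝ E = D * D * D := by
      rw [hD, ← mul_pow, ← mul_pow]; norm_num
    rw [h8, ENNReal.mul_inv (.inr (by simp [ENNReal.mul_eq_top])) (.inr (by simp)),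
      ENNReal.mul_inv (.inl (mul_ne_zero hD0 hD0)) (.inl (ENNReal.mul_ne_top hDt hDt)),
      ENNReal.mul_inv (.inl hD0) (.inl hDt), ENNReal.mul_inv (by simp) (by simp),
      ENNReal.inv_pow (a := ((finrank ℝ E + 2 : ℕ) : ℝ≥0∞)), ← hη, hs, div_eq_mul_inv]
    ring
  calc _ = s * η * D⁻¹ * D⁻¹ := hconst
    _ = ∫⁻ x, s * η * D⁻¹ * h ((2 : ℝ) • x - p) ^ 2 := by
      rw [lintegral_const_mul _ (by fun_prop),
        lintegral_comp_two_smul_sub (F := fun x => h x ^ 2) p (by fun_prop), hint, mul_one]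
    _ ≤ _ := lintegral_mono hdepth

end Density

/-! ### Ball averages of log-concave measures and the limit `ε → 0`. -/

section LogConcave

variable {E : Type*} [NormedAddCommGroup E] [InnerProductSpace ℝ E] [FiniteDimensional ℝ E]
  [MeasurableSpace E] {μ : Measure E}

theorem measure_closedBall_rpow_mul_le
    (hμ : ∀ A B : Set E, IsCompact A → IsCompact B → ∀ l : ℝ, 0 < l → l < 1 →
      μ A ^ l * μ B ^ (1 - l) ≤ μ (l • A + (1 - l) • B))
    {ε : ℝ} (hε : 0 ≤ ε) (x y : E) {l : ℝ} (hl : 0 < l) (hl' : l < 1) :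
    μ (closedBall x ε) ^ l * μ (closedBall y ε) ^ (1 - l) ≤
      μ (closedBall (l • x + (1 - l) • y) ε) := by
  refine (hμ _ _ (isCompact_closedBall x ε) (isCompact_closedBall y ε) l hl hl').trans_eq ?_
  have hl'' : 0 < 1 - l := sub_pos.2 hl'
  rw [smul_closedBall _ _ hε, smul_closedBall _ _ hε, closedBall_add_closedBall (by positivity)
    (by positivity), Real.norm_of_nonneg hl.le, Real.norm_of_nonneg hl''.le]
  congr 2
  ring

theorem convex_le_measure_closedBall [IsFiniteMeasure μ]
    (hμ : ∀ A B : Set E, IsCompact A → IsCompact B → ∀ l : ℝ, 0 < l → l < 1 →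
      μ A ^ l * μ B ^ (1 - l) ≤ μ (l • A + (1 - l) • B))
    {ε : ℝ} (hε : 0 ≤ ε) (t : ℝ≥0∞) : Convex ℝ {x | t ≤ μ (closedBall x ε)} := by
  rw [convex_iff_forall_pos]
  intro x hx y hy a b ha hb hab
  obtain rfl : b = 1 - a := by linarith
  rcases eq_or_ne t 0 with rfl | ht0
  · exact bot_le (α := ℝ≥0∞)
  have ht : t ≠ ∞ := ((show t ≤ _ from hx).trans_lt (measure_lt_top _ _)).ne
  calc t = t ^ a * t ^ (1 - a) := by
        rw [← ENNReal.rpow_add _ _ ht0 ht, hab, ENNReal.rpow_one]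
    _ ≤ μ (closedBall x ε) ^ a * μ (closedBall y ε) ^ (1 - a) :=
        mul_le_mul' (ENNReal.rpow_le_rpow hx ha.le) (ENNReal.rpow_le_rpow hy hb.le)
    _ ≤ _ := measure_closedBall_rpow_mul_le hμ hε x y ha (by linarith)

variable [BorelSpace E]

/-- By outer regularity and compactness, a thickening of the ball has mass below `t`, and it
contains all nearby balls of the same radius. -/
theorem upperSemicontinuous_measure_closedBall (μ : Measure E) [IsFiniteMeasure μ] (ε : ℝ) :
    UpperSemicontinuous fun x => μ (closedBall x ε) := by
  intro x t ht
  obtain ⟨U, hxU, hU, hUt⟩ := (closedBall x ε).exists_isOpen_lt_of_lt t ht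
  obtain ⟨δ, hδ, hδU⟩ := (isCompact_closedBall x ε).exists_cthickening_subset_open hU hxU
  filter_upwards [closedBall_mem_nhds x hδ] with y hy
  refine (measure_mono fun z hz => hδU ?_).trans_lt hUt
  refine mem_cthickening_of_dist_le z (z + (x - y)) δ _ ?_ ?_
  · rw [mem_closedBall, dist_eq_norm] at hz ⊢
    convert hz using 2
    abel
  · rw [mem_closedBall, dist_comm, dist_eq_norm] at hy
    rw [dist_eq_norm]
    convert hy using 1
    rw [← norm_neg]
    congr 1
    abel

theorem lintegral_mul_measure_closedBall (μ : Measure E) [IsFiniteMeasure μ] (ε : ℝ)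
    {F : E → ℝ≥0∞} (hF : Measurable F) :
    ∫⁻ x, F x * μ (closedBall x ε) = ∫⁻ y, (∫⁻ x in closedBall y ε, F x) ∂μ := by
  have hS : MeasurableSet {q : E × E | dist q.2 q.1 ≤ ε} :=
    (isClosed_le (by fun_prop) continuous_const).measurableSet
  have h1 : ∀ x, F x * μ (closedBall x ε) =
      ∫⁻ y, {q : E × E | dist q.2 q.1 ≤ ε}.indicator (fun q => F q.1) (x, y) ∂μ := by
    intro x
    rw [← setLIntegral_const, ← lintegral_indicator measurableSet_closedBall]
    rfl
  have h2 : ∀ y, ∫⁻ x in closedBall y ε, F x =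
      ∫⁻ x, {q : E × E | dist q.2 q.1 ≤ ε}.indicator (fun q => F q.1) (x, y) := by
    intro y
    rw [← lintegral_indicator measurableSet_closedBall]
    refine lintegral_congr fun x => ?_
    simp only [indicator, mem_closedBall, mem_ofPred_eq, dist_comm]
  simp only [h1, h2]
  exact lintegral_lintegral_swap ((hF.comp measurable_fst).indicator hS).aemeasurable

/-- Averaging over balls of radius `ε` decreases the expected depth, up to a shift by `2 * ε`. -/
theorem lintegral_shiftedDepth_ballAverage_le (μ : Measure E) [IsProbabilityMeasure μ] {ε : ℝ}
    (hε : 0 < ε) {g : E → ℝ≥0∞} (hg : ∀ x, g x = μ (closedBall x ε) / volume (closedBall (0 : E) ε))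
    (hint : ∫⁻ x, g x = 1) :
    ∫⁻ x, shiftedDepth (volume.withDensity g) 0 x * g x ≤ ∫⁻ y, shiftedDepth μ (2 * ε) y ∂μ := by
  set V := volume (closedBall (0 : E) ε) with hV
  have hV0 : V ≠ 0 := (measure_closedBall_pos _ _ hε).ne'
  have hVt : V ≠ ∞ := measure_closedBall_lt_top.ne
  have hvol : ∀ y : E, volume (closedBall y ε) = V := fun y =>
    Measure.addHaar_closedBall_center _ _ _
  have hgV : ∀ x, g x = V⁻¹ * μ (closedBall x ε) := fun x => by
    rw [hg, ENNReal.div_eq_inv_mul]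
  set ν : Measure E := volume.withDensity g with hν
  have : IsProbabilityMeasure ν := ⟨by rw [hν, withDensity_apply _ .univ, setLIntegral_univ, hint]⟩
  have hcompare : ∀ (u : sphere (0 : E) 1) (a : ℝ),
      ν {w | a ≤ inner ℝ (u : E) w} ≤ μ {w | a - ε ≤ inner ℝ (u : E) w} := by
    intro u a
    have hHm := measurableSet_le_inner (u : E) a
    have hball : ∀ y : E, ∫⁻ x in closedBall y ε,
        {w | a ≤ inner ℝ (u : E) w}.indicator (fun _ => V⁻¹) x ≤
          {w | a - ε ≤ inner ℝ (u : E) w}.indicator 1 y := by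
      intro y
      by_cases hy : y ∈ {w | a - ε ≤ inner ℝ (u : E) w}
      · rw [indicator_of_mem hy, Pi.one_apply]
        calc _ ≤ ∫⁻ x in closedBall y ε, V⁻¹ :=
              lintegral_mono fun x => indicator_le_self' (fun _ _ => zero_le) x
          _ = 1 := by rw [setLIntegral_const, hvol, ENNReal.inv_mul_cancel hV0 hVt]
      · rw [indicator_of_notMem hy, nonpos_iff_eq_zero]
        rw [setLIntegral_congr_fun (g := fun _ => 0) measurableSet_closedBall, lintegral_zero]
        intro x hx
        refine indicator_of_notMem (fun hx' => hy ?_) _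
        have h1 : inner ℝ (u : E) (x - y) ≤ ε := by
          refine (real_inner_le_norm _ _).trans ?_
          rw [norm_eq_of_mem_sphere u, one_mul, ← dist_eq_norm]
          exact hx
        rw [inner_sub_right] at h1
        simp only [mem_ofPred_eq] at hx' ⊢
        linarith
    calc ν {w | a ≤ inner ℝ (u : E) w}
        = ∫⁻ x, {w | a ≤ inner ℝ (u : E) w}.indicator (fun _ => V⁻¹) x * μ (closedBall x ε) := by
          rw [hν, withDensity_apply _ hHm, ← lintegral_indicator hHm]
          refine lintegral_congr fun x => ?_
          by_cases hx : x ∈ {w | a ≤ inner ℝ (u : E) w}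
          · rw [indicator_of_mem hx, indicator_of_mem hx, hgV]
          · rw [indicator_of_notMem hx, indicator_of_notMem hx, zero_mul]
      _ = ∫⁻ y, (∫⁻ x in closedBall y ε,
            {w | a ≤ inner ℝ (u : E) w}.indicator (fun _ => V⁻¹) x) ∂μ :=
          lintegral_mul_measure_closedBall μ ε (measurable_const.indicator hHm)
      _ ≤ ∫⁻ y, {w | a - ε ≤ inner ℝ (u : E) w}.indicator 1 y ∂μ := lintegral_mono hball
      _ = _ := lintegral_indicator_one (measurableSet_le_inner _ _)
  -- One `ε` comes from `hcompare`, the other from moving the base point from `x` to `y`.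
  have hdepth : ∀ y : E, ∀ x ∈ closedBall y ε,
      shiftedDepth ν 0 x * V⁻¹ ≤ shiftedDepth μ (2 * ε) y * V⁻¹ := by
    intro y x hx
    gcongr
    refine iInf_mono fun u => (hcompare u _).trans (measure_mono fun w hw => ?_)
    have h1 : inner ℝ (u : E) (y - x) ≤ ε := by
      refine (real_inner_le_norm _ _).trans ?_
      rw [norm_eq_of_mem_sphere u, one_mul, ← dist_eq_norm, dist_comm]
      exact hx
    rw [inner_sub_right] at h1
    simp only [mem_ofPred_eq] at hw ⊢
    linarith
  calc ∫⁻ x, shiftedDepth ν 0 x * g x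
      = ∫⁻ x, (shiftedDepth ν 0 x * V⁻¹) * μ (closedBall x ε) := by simp only [hgV, mul_assoc]
    _ = ∫⁻ y, (∫⁻ x in closedBall y ε, shiftedDepth ν 0 x * V⁻¹) ∂μ :=
        lintegral_mul_measure_closedBall μ ε
          ((upperSemicontinuous_shiftedDepth ν 0).measurable.mul_const _)
    _ ≤ ∫⁻ y, (∫⁻ x in closedBall y ε, shiftedDepth μ (2 * ε) y * V⁻¹) ∂μ :=
        lintegral_mono fun y => setLIntegral_mono' measurableSet_closedBall (hdepth y)
    _ = _ := by
        refine lintegral_congr fun y => ?_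
        rw [setLIntegral_const, hvol, mul_assoc, ENNReal.inv_mul_cancel hV0 hVt, mul_one]

theorem le_lintegral_shiftedDepth_two_mul [IsProbabilityMeasure μ]
    (hμ : ∀ A B : Set E, IsCompact A → IsCompact B → ∀ l : ℝ, 0 < l → l < 1 →
      μ A ^ l * μ B ^ (1 - l) ≤ μ (l • A + (1 - l) • B)) {ε : ℝ} (hε : 0 < ε) :
    (8 ^ finrank ℝ E * (2 * ((finrank ℝ E + 2 : ℕ) : ℝ≥0∞) ^ 2))⁻¹ ≤ ∫⁻ y, shiftedDepth μ (2 * ε) y ∂μ := by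
  set V := volume (closedBall (0 : E) ε) with hV
  have hV0 : V ≠ 0 := (measure_closedBall_pos _ _ hε).ne'
  have hVt : V ≠ ∞ := measure_closedBall_lt_top.ne
  set G : E → ℝ≥0∞ := fun x => μ (closedBall x ε) with hG
  have hGm : Measurable G := (upperSemicontinuous_measure_closedBall μ ε).measurable
  -- The square root of the averaged density, so that midpoint log-concavity needs no fractional
  -- powers.
  set h : E → ℝ≥0∞ := fun x => (G x / V) ^ (2⁻¹ : ℝ) with hh
  have hsq : ∀ x, h x ^ 2 = G x / V := fun x => by
    rw [hh, ← ENNReal.rpow_natCast, ← ENNReal.rpow_mul]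
    norm_num
  have hlevel : ∀ t, {x | t ≤ h x} = {x | t ^ 2 * V ≤ G x} := by
    intro t
    ext x
    rw [mem_ofPred_eq, mem_ofPred_eq, ← ENNReal.le_div_iff_mul_le (.inl hV0) (.inl hVt), ← hsq,
      ENNReal.pow_le_pow_left_iff two_ne_zero]
  have hint : ∫⁻ x, h x ^ 2 = 1 := by
    simp only [hsq, ENNReal.div_eq_inv_mul, hG]
    rw [lintegral_mul_measure_closedBall μ ε measurable_const]
    have hone : ∀ y : E, ∫⁻ _ in closedBall y ε, V⁻¹ = 1 := fun y => by
      rw [setLIntegral_const, Measure.addHaar_closedBall_center]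
      exact ENNReal.inv_mul_cancel hV0 hVt
    simp only [hone, lintegral_const, measure_univ, mul_one]
  have hmain := le_lintegral_shiftedDepth_of_density (h := h) ((hGm.div_const V).pow_const _)
    (fun x => ENNReal.rpow_ne_top_of_nonneg (by norm_num)
      (ENNReal.div_ne_top (measure_ne_top _ _) hV0))
    (fun t => by
      rw [hlevel]
      exact (upperSemicontinuous_measure_closedBall μ ε).isClosed_preimage _)
    (fun t => by
      rw [hlevel]
      exact convex_le_measure_closedBall hμ hε.le _)
    (fun x y => by
      have h1 := measure_closedBall_rpow_mul_le hμ hε.le x y (l := 2⁻¹) (by norm_num) (by norm_num)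
      rw [show (1 : ℝ) - 2⁻¹ = 2⁻¹ by norm_num, ← smul_add,
        ← ENNReal.mul_rpow_of_nonneg _ _ (by norm_num)] at h1
      rw [hsq, hh, ← ENNReal.mul_rpow_of_nonneg _ _ (by norm_num)]
      rw [ENNReal.le_div_iff_mul_le (.inl hV0) (.inl hVt)]
      refine le_trans (le_of_eq ?_) h1
      have hVV : V = (V * V) ^ (2⁻¹ : ℝ) := by
        rw [← sq, ← ENNReal.rpow_natCast, ← ENNReal.rpow_mul]
        norm_num
      conv_lhs => arg 2; rw [hVV]
      rw [← ENNReal.mul_rpow_of_nonneg _ _ (by norm_num)]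
      congr 1
      calc G x / V * (G y / V) * (V * V) = (G x / V * V) * (G y / V * V) := by ring
        _ = _ := by rw [ENNReal.div_mul_cancel hV0 hVt, ENNReal.div_mul_cancel hV0 hVt])
    hint
  exact hmain.trans (lintegral_shiftedDepth_ballAverage_le μ hε hsq hint)

/-- Nontriviality makes the unit sphere nonempty, so depths are at most 1 and the decreasing limit
passes through the integral. -/
theorem le_lintegral_shiftedDepth_zero [IsProbabilityMeasure μ] [Nontrivial E]
    (hμ : ∀ A B : Set E, IsCompact A → IsCompact B → ∀ l : ℝ, 0 < l → l < 1 →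
      μ A ^ l * μ B ^ (1 - l) ≤ μ (l • A + (1 - l) • B)) :
    (8 ^ finrank ℝ E * (2 * ((finrank ℝ E + 2 : ℕ) : ℝ≥0∞) ^ 2))⁻¹ ≤ ∫⁻ y, shiftedDepth μ 0 y ∂μ := by
  simp only [shiftedDepth_zero_eq_iInf μ]
  rw [lintegral_iInf (fun k => (upperSemicontinuous_shiftedDepth μ _).measurable)]
  · exact le_iInf fun k => le_lintegral_shiftedDepth_two_mul hμ Nat.one_div_pos_of_nat
  · intro i j hij x
    exact shiftedDepth_mono μ x (mul_le_mul_of_nonneg_left (Nat.one_div_le_one_div hij) zero_le_two)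
  · obtain ⟨u⟩ : Nonempty (sphere (0 : E) 1) := (NormedSpace.sphere_nonempty.2 zero_le_one).to_subtype
    refine ((lintegral_mono fun x => (iInf_le _ u).trans prob_le_one).trans_lt ?_).ne
    simp

end LogConcave

/-! ### Return to the real-valued depth and the final constant. -/

theorem halfSpaceDepth_eq_toReal_shiftedDepth {n : ℕ} (hn : 1 ≤ n)
    (μ : Measure (EuclideanSpace ℝ (Fin n))) [IsFiniteMeasure μ] (x : EuclideanSpace ℝ (Fin n)) :
    halfSpaceDepth μ x = (shiftedDepth μ 0 x).toReal := by
  have : Nonempty (Fin n) := ⟨⟨0, hn⟩⟩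
  have hne : Nonempty (sphere (0 : EuclideanSpace ℝ (Fin n)) 1) :=
    (NormedSpace.sphere_nonempty.2 zero_le_one).to_subtype
  rw [shiftedDepth, ENNReal.toReal_iInf fun u => measure_ne_top _ _]
  have hbdd : BddBelow (range fun u : sphere (0 : EuclideanSpace ℝ (Fin n)) 1 =>
      (μ {y | inner ℝ (u : EuclideanSpace ℝ (Fin n)) x - 0 ≤ inner ℝ (u : EuclideanSpace ℝ (Fin n)) y}).toReal) :=
    ⟨0, by rintro _ ⟨u, rfl⟩; exact ENNReal.toReal_nonneg⟩
  have hmem : ∀ u : sphere (0 : EuclideanSpace ℝ (Fin n)) 1,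
      (μ {y | inner ℝ (u : EuclideanSpace ℝ (Fin n)) x - 0 ≤ inner ℝ (u : EuclideanSpace ℝ (Fin n)) y}).toReal ∈
        {r : ℝ | ∃ H : Set (EuclideanSpace ℝ (Fin n)), IsHalfSpace H ∧ x ∈ H ∧ r = μ.real H} :=
    fun u => ⟨_, ⟨u, ne_of_mem_sphere u.2 one_ne_zero, _, rfl⟩, by simp, rfl⟩
  refine le_antisymm (le_ciInf fun u => csInf_le ⟨0, ?_⟩ (hmem u)) (le_csInf ⟨_, hmem hne.some⟩ ?_)
  · rintro _ ⟨H, -, -, rfl⟩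
    exact measureReal_nonneg
  · rintro _ ⟨H, ⟨v, hv, a, rfl⟩, hx, rfl⟩
    have hv' : 0 < ‖v‖ := norm_pos_iff.2 hv
    -- Any half-space containing `x` contains the parallel one bounded at `x`, whose normal can be
    -- normalised.
    refine (ciInf_le hbdd ⟨‖v‖⁻¹ • v, by simp [norm_smul, hv'.ne']⟩).trans ?_
    refine measureReal_mono fun y hy => ?_
    simp only [mem_ofPred_eq, real_inner_smul_left, sub_zero] at hx hy ⊢
    exact hx.trans (le_of_mul_le_mul_left hy (inv_pos.2 hv'))

theorem theorem1p3 :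
    ∃ c : ℝ, 0 < c ∧ ∀ n : ℕ, 1 ≤ n →
      ∀ μ : Measure (EuclideanSpace ℝ (Fin n)), IsProbabilityMeasure μ → IsLogConcaveMeasure μ →
        Integrable (fun x => halfSpaceDepth μ x) μ ∧
        Real.exp (-c * n) ≤ ∫ x, halfSpaceDepth μ x ∂μ := by
  refine ⟨Real.log 144, Real.log_pos (by norm_num), fun n hn μ hμ hlc => ?_⟩
  have : Nonempty (Fin n) := ⟨⟨0, hn⟩⟩
  have hle : ∀ x, shiftedDepth μ 0 x ≤ 1 := fun x => by
    obtain ⟨u⟩ : Nonempty (sphere (0 : EuclideanSpace ℝ (Fin n)) 1) :=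
      (NormedSpace.sphere_nonempty.2 zero_le_one).to_subtype
    exact (iInf_le _ u).trans prob_le_one
  have hmeas : Measurable (shiftedDepth μ 0) := (upperSemicontinuous_shiftedDepth μ 0).measurable
  have hlint : ∫⁻ x, shiftedDepth μ 0 x ∂μ ≠ ∞ :=
    ((lintegral_mono hle).trans_lt (by simp)).ne
  simp only [halfSpaceDepth_eq_toReal_shiftedDepth hn μ]
  refine ⟨integrable_toReal_of_lintegral_ne_top hmeas.aemeasurable hlint, ?_⟩
  rw [integral_toReal hmeas.aemeasurable (.of_forall fun x => (hle x).trans_lt ENNReal.one_lt_top)]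
  have hmain := ENNReal.toReal_mono hlint (le_lintegral_shiftedDepth_zero hlc.rpow_mul_rpow_le)
  refine le_trans ?_ hmain
  rw [finrank_euclideanSpace_fin, ENNReal.toReal_inv, neg_mul, Real.exp_neg, mul_comm (Real.log _),
    Real.exp_nat_mul, Real.exp_log (by norm_num)]
  simp only [ENNReal.toReal_mul, ENNReal.toReal_pow, ENNReal.toReal_ofNat, ENNReal.toReal_natCast]
  refine inv_anti₀ (by positivity) ?_
  -- The base 18 is forced by equality in dimension 1; then `144 = 8 * 18`.
  have hgrow : ∀ m : ℕ, 2 * (m + 1 + 2) ^ 2 ≤ 18 ^ (m + 1) := by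
    intro m
    induction m with
    | zero => norm_num
    | succ k ih =>
      calc 2 * (k + 1 + 1 + 2) ^ 2 ≤ 2 * (2 * (k + 1 + 2)) ^ 2 := by gcongr; lia
        _ ≤ 2 * (k + 1 + 2) ^ 2 * 18 := by rw [mul_pow]; lia
        _ ≤ 18 ^ (k + 1) * 18 := Nat.mul_le_mul_right _ ih
        _ = _ := (pow_succ _ _).symm
  obtain ⟨m, rfl⟩ := Nat.exists_eq_add_of_le' hn
  calc (8 : ℝ) ^ (m + 1) * (2 * ((m + 1 + 2 : ℕ) : ℝ) ^ 2) ≤ 8 ^ (m + 1) * 18 ^ (m + 1) := by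
        gcongr
        exact_mod_cast hgrow m
    _ = 144 ^ (m + 1) := by rw [← mul_pow]; norm_num
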